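/- **Corollary 3.1.** Let $n\in\mathbb N$, $t_0\in\mathbb R$, and let $P,Q,R,S$ be complex $n\times n$ matrix functions on $[t_0,\infty)$ with locally integrable entries. Here "absolutely continuous on an interval $J$" means absolutely continuous on every compact subinterval of $J$. $A^*$ is the conjugate transpose, and for Hermitian $H_1,H_2$ we write $H_1\ge H_2$ ($H_1>H_2$) if $H_1-H_2$ is positive semidefinite (positive definite). Consider the matrix Riccati equation $$Z'+ZP(t)Z+Q(t)Z+ZR(t)+S(t)=0,\qquad t\ge t_0. \tag{1}$$ A solution of (1) on an interval $J\subset[t_0,\infty)$ is an absolutely continuous $n\times n$ matrix function on $J$ satisfying (1) almost everywhere on $J$. For absolutely continuous $U,\Lambda$ with $\det U(t)\neq0$ for all $t\ge t_0$ put $$S_{U,\Lambda}=\Lambda'+\Lambda PU\Lambda+\left[U^{-1}U'+U^{-1}QU\right]\Lambda+\Lambda R+U^{-1}S .$$ Suppose that $P$ is absolutely continuous on $[t_0,\infty)$ with $\det P(t)\ne0$ for all $t\ge t_0$, and that for some absolutely continuous $n\times n$ matrix function $\Lambda$ and some real-valued locally integrable function $\mu$ on $[t_0,\infty)$, for almost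 every $t\ge t_0$, $$R=PQ^*P^{-1}+PP^*(\Lambda^*-\Lambda)+P'P^{-1}+\mu I \qquad\text{and}\qquad S_{P^*,\Lambda}+S_{P^*,\Lambda}^*\le 0 .$$ Then: 1. Every solution $Z$ of (1) with $(P^{-1}(t_0))^*Z(t_0)+Z^*(t_0)P^{-1}(t_0)>\Lambda(t_0)+\Lambda^*(t_0)$ exists on $[t_0,\infty)$ and satisfies $$(P^{-1}(t))^*Z(t)+Z^*(t)P^{-1}(t)>\Lambda(t)+\Lambda^*(t),\qquad t\ge t_0 .$$ 2. If moreover $P^{-1}(t_0)+(P^{-1}(t_0))^*>0$, then every solution $Z$ of (1) with $(P^{-1}(t_0))^*Z(t_0)+Z^*(t_0)P^{-1}(t_0)\ge\Lambda(t_0)+\Lambda^*(t_0)$ exists on $[t_0,\infty)$ and satisfies $$(P^{-1}(t))^*Z(t)+Z^*(t)P^{-1}(t)\ge\Lambda(t)+\Lambda^*(t),\qquad t\ge t_0 .$$ Here "every solution exists on $[t_0,\infty)$" means: for every matrix $M$ satisfying the stated inequality in place of $Z(t_0)$, there is a solution $Z$ on $[t_0,\infty)$ with $Z(t_0)=M$,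 and every solution on an interval $[t_0,T)$, $T>t_0$, with value $M$ at $t_0$ is the restriction of $Z$. -/

import Mathlib

open scoped Matrix ComplexOrder

namespace MatrixRiccati

/-- The entrywise derivative of a matrix function. For a locally absolutely continuous matrix
function it is the true derivative at almost every point. -/
noncomputable def matDeriv {n : ℕ} (A : ℝ → Matrix (Fin n) (Fin n) ℂ) (t : ℝ) :
    Matrix (Fin n) (Fin n) ℂ :=
  Matrix.of fun i j => deriv (fun s => A s i j) t

/-- Local integrability (with respect to Lebesgue measure) on the set `I`, entry by entry. -/
def MatLocallyIntegrableOn {n : ℕ} (A : ℝ → Matrix (Fin n) (Fin n) ℂ) (I : Set ℝ) : Prop :=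
  ∀ i j, MeasureTheory.LocallyIntegrableOn (fun t => A t i j) I

/-- Absolute continuity on the interval `I`, in the sense usual for differential equations:
every entry is absolutely continuous on every compact subinterval `[a, b]` of `I`. -/
def MatAbsContOn {n : ℕ} (A : ℝ → Matrix (Fin n) (Fin n) ℂ) (I : Set ℝ) : Prop :=
  ∀ a b : ℝ, Set.uIcc a b ⊆ I → ∀ i j,
    AbsolutelyContinuousOnInterval (fun t => A t i j) a b

/-- `Z` is a solution on the interval `I` of the matrix Riccati equation
`Z' + Z P Z + Q Z + Z R + S = 0`: it is absolutely continuous on compact subintervals of `I` and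
satisfies the equation at almost every point of `I`. -/
def IsSolutionOn {n : ℕ} (P Q R S : ℝ → Matrix (Fin n) (Fin n) ℂ) (I : Set ℝ)
    (Z : ℝ → Matrix (Fin n) (Fin n) ℂ) : Prop :=
  MatAbsContOn Z I ∧
    ∀ᵐ t : ℝ, t ∈ I →
      matDeriv Z t + Z t * P t * Z t + Q t * Z t + Z t * R t + S t = 0

/-- The matrix function
`S_{U,Λ} = Λ' + Λ P U Λ + (U⁻¹ U' + U⁻¹ Q U) Λ + Λ R + U⁻¹ S`. -/
noncomputable def transformedS {n : ℕ} (P Q R S U L : ℝ → Matrix (Fin n) (Fin n) ℂ) (t : ℝ) :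
    Matrix (Fin n) (Fin n) ℂ :=
  matDeriv L t + L t * P t * U t * L t
    + ((U t)⁻¹ * matDeriv U t + (U t)⁻¹ * Q t * U t) * L t
    + L t * R t + (U t)⁻¹ * S t

end MatrixRiccati

/-!
The Riccati equation is linearized: if `W' = R W + P N`, `N' = -S W - Q N` with `W t₀ = 1`,
`N t₀ = M`, then `Z = N W⁻¹` is the solution with `Z t₀ = M` as long as `W` is invertible. The
linear system has locally integrable coefficients, so it is solvable on all of `[t₀, ∞)`
(`absContWithDeriv_linearFlow`, by the Picard series), and global existence amounts to the
invertibility of `W`.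

Put `U = P*`, `V = U⁻¹ N - Λ W` and `E = W* V + V* W`. Where `W` is invertible,
`U⁻¹ Z + Z* P⁻¹ - (Λ + Λ*) = W⁻* E W⁻¹`, so the assertion is about the sign of `E`. With
`C = U⁻¹ U' + U⁻¹ Q U + Λ P U`, the hypothesis on `R` says exactly that
`W' = P P* V + (C* + μ) W`, while `V' = -C V - S_{U,Λ} W`. The terms with `C` cancel in `E'`, and
`E' = μ E + 2 V* P P* V - W* (S_{U,Λ} + S_{U,Λ}*) W` (`absContWithDeriv_energy`). The last two
terms are nonnegative, so `exp (-∫ μ) v* E v` is nondecreasing for each vector `v`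
(`LinearizedRiccati.energy_le`), and both `E ≥ 0` and `E > 0` propagate from `t₀`.

The same monotonicity gives invertibility of `W` (`LinearizedRiccati.det_denominator_ne_zero`).
If `W(b) v = 0`, then `v* E(b) v = 0`, so `v* E v` vanishes on `[t₀, b]`, hence so does `V v`, by
the strict positivity of `P P*`. Then `W v` solves the homogeneous equation
`w' = (R + P P* Λ) w` with `w(b) = 0`, so `v = W(t₀) v = 0`.

A second solution `Y` with the same initial value is compared through `D = N - Y W`, which solves
`D' = -(Q + Y P) D`, `D(t₀) = 0`. Uniqueness for linear equations is itself reduced to existence: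
a solution of the adjoint equation is an integrating factor (`exists_integratingFactor`).
-/

namespace MatrixRiccati

open MeasureTheory Set Filter Topology

open scoped Matrix.Norms.L2Operator

/-! ### Absolutely continuous functions and their derivatives -/

section Calculus

variable {X Y G F : Type*} [PseudoMetricSpace X] [PseudoMetricSpace Y] [PseudoMetricSpace G]
  {a b : ℝ}

/-- A function whose increments are controlled by those of two absolutely continuous functions is
absolutely continuous. Products, inverses and compositions all reduce to this. -/
theorem absolutelyContinuousOnInterval_of_dist_le_add {f : ℝ → X} {g : ℝ → Y} {h : ℝ → G}
    (hf : AbsolutelyContinuousOnInterval f a b) (hg : AbsolutelyContinuousOnInterval g a b)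
    (C D : ℝ) (hle : ∀ s ∈ uIcc a b, ∀ t ∈ uIcc a b,
      dist (h s) (h t) ≤ C * dist (f s) (f t) + D * dist (g s) (g t)) :
    AbsolutelyContinuousOnInterval h a b := by
  unfold AbsolutelyContinuousOnInterval at *
  have hlim := (hf.const_mul C).add (hg.const_mul D)
  simp only [mul_zero, add_zero] at hlim
  refine tendsto_of_tendsto_of_tendsto_of_le_of_le' tendsto_const_nhds hlim
    (Eventually.of_forall fun E => Finset.sum_nonneg fun _ _ => dist_nonneg) ?_
  refine eventually_inf_principal.2 (Eventually.of_forall fun E hE => ?_)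
  rw [Finset.mul_sum, Finset.mul_sum, ← Finset.sum_add_distrib]
  exact Finset.sum_le_sum fun i hi => hle _ (hE.1 i hi).1 _ (hE.1 i hi).2

theorem absolutelyContinuousOnInterval_of_dist_le {f : ℝ → X} {h : ℝ → G}
    (hf : AbsolutelyContinuousOnInterval f a b) (C : ℝ)
    (hle : ∀ s ∈ uIcc a b, ∀ t ∈ uIcc a b, dist (h s) (h t) ≤ C * dist (f s) (f t)) :
    AbsolutelyContinuousOnInterval h a b :=
  absolutelyContinuousOnInterval_of_dist_le_add hf hf C 0 fun s hs t ht => by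
    simpa using hle s hs t ht

/-- `f` is absolutely continuous on the interval with endpoints `a`, `b`, and `f'` is its
derivative at almost every point of the interval. -/
structure AbsContWithDeriv [NormedAddCommGroup F] [NormedSpace ℝ F] (f f' : ℝ → F) (a b : ℝ) :
    Prop where
  absCont : AbsolutelyContinuousOnInterval f a b
  hasDerivAt : ∀ᵐ t : ℝ, t ∈ uIcc a b → HasDerivAt f (f' t) t

namespace AbsContWithDeriv

section Linear

variable [NormedAddCommGroup F] [NormedSpace ℝ F] {f g f' g' : ℝ → F}
  {H : Type*} [NormedAddCommGroup H] [NormedSpace ℝ H]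

theorem continuousOn (hf : AbsContWithDeriv f f' a b) : ContinuousOn f (uIcc a b) :=
  hf.absCont.continuousOn

theorem congr_deriv (hf : AbsContWithDeriv f f' a b)
    (h : ∀ᵐ t : ℝ, t ∈ uIcc a b → f' t = g' t) : AbsContWithDeriv f g' a b :=
  ⟨hf.absCont, by
    filter_upwards [hf.hasDerivAt, h] with t ht h hmem using h hmem ▸ ht hmem⟩

/-- Changing `f` off the interval does not affect the derivative at interior points. -/
theorem congr_of_eqOn (hf : AbsContWithDeriv f f' a b) (hab : a ≤ b)
    (h : ∀ t ∈ Icc a b, g t = f t) : AbsContWithDeriv g f' a b := by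
  refine ⟨absolutelyContinuousOnInterval_of_dist_le hf.absCont 1 fun s hs t ht => ?_, ?_⟩
  · rw [uIcc_of_le hab] at hs ht
    rw [h s hs, h t ht, one_mul]
  · filter_upwards [hf.hasDerivAt, Measure.ae_ne volume a, Measure.ae_ne volume b]
      with t ht hta htb hm
    refine (ht hm).congr_of_eventuallyEq ?_
    rw [uIcc_of_le hab] at hm
    filter_upwards [Icc_mem_nhds (lt_of_le_of_ne hm.1 hta.symm) (lt_of_le_of_ne hm.2 htb)]
      with s hs using h s hs

theorem const (c : F) : AbsContWithDeriv (fun _ => c) (fun _ => 0) a b :=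
  ⟨(LipschitzWith.const c).lipschitzOnWith.absolutelyContinuousOnInterval,
    Eventually.of_forall fun t _ => hasDerivAt_const t c⟩

theorem add (hf : AbsContWithDeriv f f' a b) (hg : AbsContWithDeriv g g' a b) :
    AbsContWithDeriv (fun t => f t + g t) (fun t => f' t + g' t) a b :=
  ⟨hf.absCont.fun_add hg.absCont, by
    filter_upwards [hf.hasDerivAt, hg.hasDerivAt] with t h1 h2 hm using (h1 hm).add (h2 hm)⟩

theorem clm_comp (hf : AbsContWithDeriv f f' a b) (L : F →L[ℝ] H) :
    AbsContWithDeriv (fun t => L (f t)) (fun t => L (f' t)) a b := by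
  refine ⟨absolutelyContinuousOnInterval_of_dist_le hf.absCont ‖L‖ fun s _ t _ => ?_, ?_⟩
  · exact L.lipschitz.dist_le_mul _ _
  · filter_upwards [hf.hasDerivAt] with t h1 hm using L.hasFDerivAt.comp_hasDerivAt t (h1 hm)

theorem neg (hf : AbsContWithDeriv f f' a b) :
    AbsContWithDeriv (fun t => -f t) (fun t => -f' t) a b :=
  hf.clm_comp (-ContinuousLinearMap.id ℝ F)

theorem sub (hf : AbsContWithDeriv f f' a b) (hg : AbsContWithDeriv g g' a b) :
    AbsContWithDeriv (fun t => f t - g t) (fun t => f' t - g' t) a b := by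
  simpa only [sub_eq_add_neg] using hf.add hg.neg

theorem sum {ι : Type*} (s : Finset ι) {f f' : ι → ℝ → F}
    (hf : ∀ i ∈ s, AbsContWithDeriv (f i) (f' i) a b) :
    AbsContWithDeriv (fun t => ∑ i ∈ s, f i t) (fun t => ∑ i ∈ s, f' i t) a b := by
  classical
  induction s using Finset.induction_on with
  | empty => simpa using AbsContWithDeriv.const (a := a) (b := b) (0 : F)
  | insert i s hi ih =>
    simp only [Finset.sum_insert hi]
    exact (hf i (Finset.mem_insert_self i s)).add
      (ih fun j hj => hf j (Finset.mem_insert_of_mem hj))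

/-- An indefinite integral is absolutely continuous and is differentiable almost everywhere
(Lebesgue). -/
theorem integral [CompleteSpace F] (hf : IntervalIntegrable f volume a b) :
    AbsContWithDeriv (fun t => ∫ s in a..t, f s) f a b := by
  have hsub : ∀ s ∈ uIcc a b, ∀ t ∈ uIcc a b, IntervalIntegrable f volume s t :=
    fun s hs t ht => hf.mono_set (uIcc_subset_uIcc hs ht)
  refine ⟨absolutelyContinuousOnInterval_of_dist_le
    (hf.norm.absolutelyContinuousOnInterval_intervalIntegral left_mem_uIcc) 1
    fun s hs t ht => ?_, ?_⟩
  · rw [dist_eq_norm, Real.dist_eq,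
      intervalIntegral.integral_interval_sub_left (hsub _ left_mem_uIcc _ hs)
        (hsub _ left_mem_uIcc _ ht),
      intervalIntegral.integral_interval_sub_left (hsub _ left_mem_uIcc _ hs).norm
        (hsub _ left_mem_uIcc _ ht).norm, one_mul]
    exact intervalIntegral.norm_integral_le_abs_integral_norm
  · filter_upwards [hf.ae_hasDerivAt_integral] with t ht hm using ht hm a left_mem_uIcc

/-- An absolutely continuous function with vanishing derivative takes equal values at the
endpoints. -/
theorem eq_of_deriv_zero (hf : AbsContWithDeriv f f' a b)
    (h : ∀ᵐ t : ℝ, t ∈ uIcc a b → f' t = 0) : f b = f a := by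
  obtain ⟨C, hC⟩ := hf.absCont.const_of_ae_hasDerivAt_zero (by
    filter_upwards [hf.hasDerivAt, h] with t ht h hm using h hm ▸ ht hm)
  rw [hC _ right_mem_uIcc, hC _ left_mem_uIcc]

end Linear

section Ring

variable {𝔸 : Type*} [NormedRing 𝔸] [NormedAlgebra ℝ 𝔸] {f g f' g' : ℝ → 𝔸}

theorem mul (hf : AbsContWithDeriv f f' a b) (hg : AbsContWithDeriv g g' a b) :
    AbsContWithDeriv (fun t => f t * g t) (fun t => f' t * g t + f t * g' t) a b := by
  obtain ⟨C, hC⟩ := hf.absCont.exists_bound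
  obtain ⟨D, hD⟩ := hg.absCont.exists_bound
  refine ⟨absolutelyContinuousOnInterval_of_dist_le_add hf.absCont hg.absCont D C
    fun s hs t ht => ?_, ?_⟩
  · have hsplit : f s * g s - f t * g t = (f s - f t) * g s + f t * (g s - g t) := by
      noncomm_ring
    rw [dist_eq_norm, dist_eq_norm, dist_eq_norm, hsplit]
    calc _ ≤ ‖f s - f t‖ * ‖g s‖ + ‖f t‖ * ‖g s - g t‖ :=
          (norm_add_le _ _).trans (add_le_add (norm_mul_le _ _) (norm_mul_le _ _))
      _ ≤ ‖f s - f t‖ * D + C * ‖g s - g t‖ := by gcongr; exacts [hD s hs, hC t ht]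
      _ = _ := by ring
  · filter_upwards [hf.hasDerivAt, hg.hasDerivAt] with t h1 h2 hm using (h1 hm).mul (h2 hm)

end Ring

section Real

variable {f f' : ℝ → ℝ}

theorem exp (hf : AbsContWithDeriv f f' a b) :
    AbsContWithDeriv (fun t => Real.exp (f t)) (fun t => Real.exp (f t) * f' t) a b := by
  obtain ⟨C, hC⟩ := hf.absCont.exists_bound
  obtain ⟨K, hK⟩ := (Real.contDiff_exp (n := 1)).contDiffOn.exists_lipschitzOnWith
    (s := Icc (-C) C) (by decide) (convex_Icc _ _) isCompact_Icc
  refine ⟨absolutelyContinuousOnInterval_of_dist_le hf.absCont K fun s hs t ht => ?_, ?_⟩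
  · exact hK.dist_le_mul _ (abs_le.1 (hC s hs)) _ (abs_le.1 (hC t ht))
  · filter_upwards [hf.hasDerivAt] with t h1 hm using (h1 hm).exp

theorem ae_deriv_eq (hf : AbsContWithDeriv f f' a b) (hab : a ≤ b) :
    deriv f =ᵐ[volume.restrict (Icc a b)] f' := by
  rw [Filter.EventuallyEq, ae_restrict_iff' measurableSet_Icc]
  filter_upwards [hf.hasDerivAt] with t ht hm
  exact (ht (by rwa [uIcc_of_le hab])).deriv

theorem intervalIntegrable (hf : AbsContWithDeriv f f' a b) (hab : a ≤ b) :
    IntervalIntegrable f' volume a b := by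
  refine hf.absCont.intervalIntegrable_deriv.congr_ae ?_
  rw [uIoc_of_le hab]
  exact ae_restrict_of_ae_restrict_of_subset Ioc_subset_Icc_self (hf.ae_deriv_eq hab)

theorem integral_eq_sub (hf : AbsContWithDeriv f f' a b) (hab : a ≤ b) :
    ∫ t in a..b, f' t = f b - f a := by
  rw [← hf.absCont.integral_deriv_eq_sub]
  refine intervalIntegral.integral_congr_ae_restrict (Filter.EventuallyEq.symm ?_)
  rw [uIoc_of_le hab]
  exact ae_restrict_of_ae_restrict_of_subset Ioc_subset_Icc_self (hf.ae_deriv_eq hab)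

theorem le_of_deriv_nonneg (hf : AbsContWithDeriv f f' a b) (hab : a ≤ b)
    (h : ∀ᵐ t : ℝ, t ∈ Icc a b → 0 ≤ f' t) : f a ≤ f b := by
  rw [← sub_nonneg, ← hf.integral_eq_sub hab]
  exact intervalIntegral.integral_nonneg_of_ae_restrict hab
    ((ae_restrict_iff' measurableSet_Icc).2 h)

/-- The case of equality in `le_of_deriv_nonneg`. -/
theorem deriv_eq_zero_of_le (hf : AbsContWithDeriv f f' a b) (hab : a ≤ b)
    (h : ∀ᵐ t : ℝ, t ∈ Icc a b → 0 ≤ f' t) (hle : f b ≤ f a) :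
    ∀ᵐ t : ℝ, t ∈ Icc a b → f' t = 0 := by
  have hint : ∫ t in a..b, f' t = 0 := by
    rw [hf.integral_eq_sub hab]
    linarith [hf.le_of_deriv_nonneg hab h]
  have hnn : 0 ≤ᵐ[volume.restrict (Ioc a b)] f' :=
    ae_restrict_of_ae_restrict_of_subset Ioc_subset_Icc_self
      ((ae_restrict_iff' measurableSet_Icc).2 h)
  have := (intervalIntegral.integral_eq_zero_iff_of_le_of_nonneg_ae hab hnn
    (hf.intervalIntegrable hab)).1 hint
  rw [restrict_Ioc_eq_restrict_Icc] at this
  exact (ae_restrict_iff' measurableSet_Icc).1 this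

end Real

end AbsContWithDeriv

end Calculus

/-! ### Linear differential equations with integrable coefficients -/

section LinearODE

/-- The weight `exp (2 ∫ ‖A‖)` turns the integral operator into a contraction of ratio `1 / 2`. -/
theorem integral_norm_mul_exp_le {𝔸 : Type*} [NormedRing 𝔸] {A : ℝ → 𝔸} {a b : ℝ}
    (hab : a ≤ b) (hA : IntervalIntegrable A volume a b) :
    IntervalIntegrable (fun s => ‖A s‖ * Real.exp (2 * ∫ r in a..s, ‖A r‖)) volume a b ∧
    ∫ s in a..b, ‖A s‖ * Real.exp (2 * ∫ r in a..s, ‖A r‖)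
      ≤ Real.exp (2 * ∫ r in a..b, ‖A r‖) / 2 := by
  have hm := ((AbsContWithDeriv.integral hA.norm).clm_comp
    ((2 : ℝ) • ContinuousLinearMap.id ℝ ℝ)).exp
  simp only [_root_.smul_apply, ContinuousLinearMap.id_apply, smul_eq_mul] at hm
  have heq : (fun s => ‖A s‖ * Real.exp (2 * ∫ r in a..s, ‖A r‖)) =
      fun s => Real.exp (2 * ∫ r in a..s, ‖A r‖) * (2 * ‖A s‖) * (1 / 2) := by
    funext s; ring
  rw [heq]
  refine ⟨(hm.intervalIntegrable hab).mul_const _, ?_⟩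
  rw [intervalIntegral.integral_mul_const, hm.integral_eq_sub hab]
  simp only [intervalIntegral.integral_same, mul_zero, Real.exp_zero]
  linarith

variable {𝔸 : Type*} [NormedRing 𝔸] [NormedAlgebra ℝ 𝔸] {a b : ℝ}

/-- The terms of the Picard (Peano-Baker) series of the initial value problem `X' = A X`,
`X a = X₀`. -/
noncomputable def picardTerm (A : ℝ → 𝔸) (a : ℝ) (X₀ : 𝔸) : ℕ → ℝ → 𝔸
  | 0 => fun _ => X₀
  | k + 1 => fun t => ∫ s in a..t, A s * picardTerm A a X₀ k s

/-- The sum of the Picard series. It solves `X' = A X`, `X a = X₀` to the right of `a`, as far as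
`A` is integrable. -/
noncomputable def linearFlow (A : ℝ → 𝔸) (a : ℝ) (X₀ : 𝔸) (t : ℝ) : 𝔸 :=
  ∑' k, picardTerm A a X₀ k t

theorem linearFlow_left (A : ℝ → 𝔸) (a : ℝ) (X₀ : 𝔸) : linearFlow A a X₀ a = X₀ := by
  refine (tsum_eq_single 0 fun k hk => ?_).trans rfl
  obtain ⟨k, rfl⟩ := Nat.exists_eq_succ_of_ne_zero hk
  simp [picardTerm]

variable {A : ℝ → 𝔸} (X₀ : 𝔸)

theorem continuousOn_picardTerm (hA : IntervalIntegrable A volume a b) (k : ℕ) :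
    ContinuousOn (picardTerm A a X₀ k) (uIcc a b) := by
  induction k with
  | zero => exact continuousOn_const
  | succ k ih =>
    have h := hA.mul_continuousOn ih
    exact intervalIntegral.continuousOn_primitive_interval' h left_mem_uIcc

theorem norm_picardTerm_le (hA : IntervalIntegrable A volume a b) (k : ℕ) {t : ℝ}
    (ht : t ∈ Icc a b) :
    ‖picardTerm A a X₀ k t‖ ≤ ‖X₀‖ * (1 / 2) ^ k * Real.exp (2 * ∫ r in a..t, ‖A r‖) := by
  induction k generalizing t with
  | zero =>
    have : 0 ≤ ∫ r in a..t, ‖A r‖ :=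
      intervalIntegral.integral_nonneg ht.1 fun _ _ => norm_nonneg _
    simpa [picardTerm] using
      le_mul_of_one_le_right (norm_nonneg X₀) (Real.one_le_exp (by positivity))
  | succ k ih =>
    have hsub : uIcc a t ⊆ uIcc a b := by
      rw [uIcc_of_le ht.1, uIcc_of_le (ht.1.trans ht.2)]; exact Icc_subset_Icc_right ht.2
    obtain ⟨hint, hle⟩ := integral_norm_mul_exp_le ht.1 (hA.mono_set hsub)
    calc ‖picardTerm A a X₀ (k + 1) t‖
        ≤ ∫ s in a..t, ‖X₀‖ * (1 / 2) ^ k *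
            (‖A s‖ * Real.exp (2 * ∫ r in a..s, ‖A r‖)) := by
          refine intervalIntegral.norm_integral_le_of_norm_le ht.1
            (Eventually.of_forall fun s hs => ?_) (hint.const_mul _)
          calc ‖A s * picardTerm A a X₀ k s‖ ≤ ‖A s‖ * ‖picardTerm A a X₀ k s‖ := norm_mul_le _ _
            _ ≤ ‖A s‖ * (‖X₀‖ * (1 / 2) ^ k * Real.exp (2 * ∫ r in a..s, ‖A r‖)) := by
                gcongr; exact ih ⟨hs.1.le, hs.2.trans ht.2⟩
            _ = _ := by ring
      _ ≤ ‖X₀‖ * (1 / 2) ^ k * (Real.exp (2 * ∫ r in a..t, ‖A r‖) / 2) := by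
          rw [intervalIntegral.integral_const_mul]; gcongr
      _ = _ := by ring

variable [CompleteSpace 𝔸]

theorem absContWithDeriv_linearFlow (hab : a ≤ b) (hA : IntervalIntegrable A volume a b) :
    AbsContWithDeriv (linearFlow A a X₀) (fun t => A t * linearFlow A a X₀ t) a b := by
  have hgeom : Summable fun k : ℕ => ((1 : ℝ) / 2) ^ k := summable_geometric_two
  -- A bound for the terms that is uniform on the whole interval.
  set K : ℝ := ‖X₀‖ * Real.exp (2 * ∫ r in a..b, ‖A r‖) with hK
  have hbound : ∀ k, ∀ t ∈ Icc a b, ‖picardTerm A a X₀ k t‖ ≤ K * (1 / 2) ^ k := by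
    intro k t ht
    refine (norm_picardTerm_le X₀ hA k ht).trans ?_
    rw [hK, mul_right_comm]
    have : ∫ r in a..t, ‖A r‖ ≤ ∫ r in a..b, ‖A r‖ :=
      intervalIntegral.integral_mono_interval le_rfl ht.1 ht.2
        (Eventually.of_forall fun _ => norm_nonneg _) hA.norm
    gcongr
  have hsum : ∀ t ∈ Icc a b, Summable fun k => picardTerm A a X₀ k t := fun t ht =>
    Summable.of_norm_bounded (hgeom.mul_left K) fun k => hbound k t ht
  have hcont : ContinuousOn (linearFlow A a X₀) (uIcc a b) := by
    refine continuousOn_tsum (continuousOn_picardTerm X₀ hA) (hgeom.mul_left K) ?_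
    intro k t ht
    exact hbound k t (by rwa [uIcc_of_le hab] at ht)
  have hprod : IntervalIntegrable (fun t => A t * linearFlow A a X₀ t) volume a b :=
    hA.mul_continuousOn hcont
  have heq : ∀ t ∈ Icc a b,
      linearFlow A a X₀ t = X₀ + ∫ s in a..t, A s * linearFlow A a X₀ s := by
    intro t ht
    have hsub : uIcc a t ⊆ uIcc a b := by
      rw [uIcc_of_le ht.1, uIcc_of_le hab]; exact Icc_subset_Icc_right ht.2
    have hmem : ∀ s ∈ uIoc a t, s ∈ Icc a b := fun s hs => by
      rw [uIoc_of_le ht.1] at hs; exact ⟨hs.1.le, hs.2.trans ht.2⟩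
    have hAt := hA.mono_set hsub
    have hs := intervalIntegral.hasSum_integral_of_dominated_convergence (μ := volume)
      (F := fun k s => A s * picardTerm A a X₀ k s)
      (f := fun s => A s * linearFlow A a X₀ s) (a := a) (b := t)
      (fun k s => ‖A s‖ * K * (1 / 2) ^ k)
      (fun k => (hAt.mul_continuousOn
        ((continuousOn_picardTerm X₀ hA k).mono hsub)).aestronglyMeasurable_restrict_uIoc)
      (fun k => Eventually.of_forall fun s hs => by
        rw [mul_assoc]
        exact (norm_mul_le _ _).trans
          (mul_le_mul_of_nonneg_left (hbound k s (hmem s hs)) (norm_nonneg _)))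
      (Eventually.of_forall fun s _ => hgeom.mul_left _)
      (by simp only [tsum_mul_left]; exact (hAt.norm.mul_const K).mul_const _)
      (Eventually.of_forall fun s hs => (hsum s (hmem s hs)).hasSum.mul_left _)
    rw [← hs.tsum_eq, linearFlow, (hsum t ht).tsum_eq_zero_add]
    rfl
  have hint := (AbsContWithDeriv.const (a := a) (b := b) X₀).add (AbsContWithDeriv.integral hprod)
  refine AbsContWithDeriv.congr_of_eqOn ?_ hab heq
  simpa using hint

end LinearODE

/-! ### Matrix functions -/

section Functionals

variable {m : Type*} [Fintype m]

/-- The real quadratic form `A ↦ Re (v* A v)`. -/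
noncomputable def reForm (v : m → ℂ) : Matrix m m ℂ →L[ℝ] ℝ :=
  LinearMap.toContinuousLinearMap
    { toFun := fun A => (star v ⬝ᵥ A *ᵥ v).re
      map_add' := fun A B => by simp [Matrix.add_mulVec, dotProduct_add]
      map_smul' := fun c A => by simp [Matrix.smul_mulVec, dotProduct_smul] }

theorem reForm_apply (v : m → ℂ) (A : Matrix m m ℂ) : reForm v A = (star v ⬝ᵥ A *ᵥ v).re := rfl

/-- The map `A ↦ A v` for a fixed vector `v`. -/
noncomputable def mulVecCLM (v : m → ℂ) : Matrix m m ℂ →L[ℝ] (m → ℂ) :=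
  LinearMap.toContinuousLinearMap
    { toFun := fun A => A *ᵥ v
      map_add' := fun A B => Matrix.add_mulVec A B v
      map_smul' := fun c A => Matrix.smul_mulVec c A v }

theorem mulVecCLM_apply (v : m → ℂ) (A : Matrix m m ℂ) : mulVecCLM v A = A *ᵥ v := rfl

end Functionals

section MatrixCalculus

variable {m : Type*} [Fintype m] [DecidableEq m] {a b : ℝ}

/-- The inclusion of the `(i, j)` entry into the space of matrices. -/
noncomputable def singleCLM (i j : m) : ℂ →L[ℝ] Matrix m m ℂ :=
  (Matrix.singleLinearMap ℝ i j : ℂ →ₗ[ℝ] Matrix m m ℂ).toContinuousLinearMap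

/-- The `(i, j)` entry of a matrix. -/
noncomputable def entryCLM (i j : m) : Matrix m m ℂ →L[ℝ] ℂ :=
  (Matrix.entryLinearMap ℝ ℂ i j : Matrix m m ℂ →ₗ[ℝ] ℂ).toContinuousLinearMap

theorem sum_singleCLM (A : Matrix m m ℂ) : ∑ i, ∑ j, singleCLM i j (A i j) = A :=
  (Matrix.matrix_eq_sum_single A).symm

theorem AbsContWithDeriv.entry {A A' : ℝ → Matrix m m ℂ} (h : AbsContWithDeriv A A' a b)
    (i j : m) : AbsContWithDeriv (fun t => A t i j) (fun t => A' t i j) a b :=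
  h.clm_comp (entryCLM i j)

theorem absContWithDeriv_of_entries {A A' : ℝ → Matrix m m ℂ}
    (h : ∀ i j, AbsContWithDeriv (fun t => A t i j) (fun t => A' t i j) a b) :
    AbsContWithDeriv A A' a b := by
  have := AbsContWithDeriv.sum Finset.univ fun i _ => AbsContWithDeriv.sum Finset.univ
    fun j _ => (h i j).clm_comp (singleCLM i j)
  simpa only [sum_singleCLM] using this

theorem intervalIntegrable_of_entries {A : ℝ → Matrix m m ℂ}
    (h : ∀ i j, IntervalIntegrable (fun t => A t i j) volume a b) :
    IntervalIntegrable A volume a b := by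
  have : IntervalIntegrable (∑ i, ∑ j, fun t => singleCLM i j (A t i j)) volume a b :=
    IntervalIntegrable.sum _ fun i _ => IntervalIntegrable.sum _ fun j _ =>
      ⟨(singleCLM i j).integrable_comp (h i j).1, (singleCLM i j).integrable_comp (h i j).2⟩
  convert this using 1
  funext t
  simp only [Finset.sum_apply, sum_singleCLM]

theorem AbsContWithDeriv.conjTranspose {A A' : ℝ → Matrix m m ℂ} (h : AbsContWithDeriv A A' a b) :
    AbsContWithDeriv (fun t => (A t)ᴴ) (fun t => (A' t)ᴴ) a b :=
  h.clm_comp ((starL' ℝ : Matrix m m ℂ ≃L[ℝ] Matrix m m ℂ) : Matrix m m ℂ →L[ℝ] Matrix m m ℂ)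

theorem AbsContWithDeriv.inv {A A' : ℝ → Matrix m m ℂ} (h : AbsContWithDeriv A A' a b)
    (hdet : ∀ t ∈ uIcc a b, (A t).det ≠ 0) :
    AbsContWithDeriv (fun t => (A t)⁻¹) (fun t => -((A t)⁻¹ * A' t * (A t)⁻¹)) a b := by
  have hunit : ∀ t ∈ uIcc a b, IsUnit (A t).det := fun t ht => (hdet t ht).isUnit
  have hcont : ContinuousOn (fun t => (A t)⁻¹) (uIcc a b) := by
    intro t ht
    obtain ⟨u, hu⟩ := (Matrix.isUnit_iff_isUnit_det _).2 (hunit t ht)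
    simp only [Matrix.nonsing_inv_eq_ringInverse]
    have := NormedRing.inverse_continuousAt u
    rw [hu] at this
    exact this.comp_continuousWithinAt (h.continuousOn t ht)
  obtain ⟨C, hC⟩ := isCompact_uIcc.exists_bound_of_continuousOn hcont
  refine ⟨absolutelyContinuousOnInterval_of_dist_le h.absCont (C * C) fun s hs t ht => ?_, ?_⟩
  · have hsplit : (A s)⁻¹ - (A t)⁻¹ = (A s)⁻¹ * (A t - A s) * (A t)⁻¹ := by
      rw [mul_sub, sub_mul, Matrix.mul_nonsing_inv_cancel_right _ _ (hunit t ht),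
        Matrix.nonsing_inv_mul _ (hunit s hs), one_mul]
    rw [dist_eq_norm, dist_eq_norm, hsplit, ← norm_neg (A s - A t), neg_sub]
    have hC0 : 0 ≤ C := (norm_nonneg _).trans (hC s hs)
    calc _ ≤ ‖(A s)⁻¹‖ * ‖A t - A s‖ * ‖(A t)⁻¹‖ :=
          (norm_mul_le _ _).trans (mul_le_mul_of_nonneg_right (norm_mul_le _ _) (norm_nonneg _))
      _ ≤ C * ‖A t - A s‖ * C := by gcongr; exacts [hC s hs, hC t ht]
      _ = _ := by ring
  · filter_upwards [h.hasDerivAt] with t ht hm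
    obtain ⟨u, hu⟩ := (Matrix.isUnit_iff_isUnit_det _).2 (hunit t hm)
    simp only [Matrix.nonsing_inv_eq_ringInverse]
    have hd := hasFDerivAt_ringInverse (𝕜 := ℝ) u
    have hcomp := HasFDerivAt.comp_hasDerivAt t (hu ▸ hd) (ht hm)
    rw [← hu, Ring.inverse_unit]
    simpa using! hcomp

/-- A complex-valued absolutely continuous function is differentiable almost everywhere. -/
theorem absContWithDeriv_deriv {f : ℝ → ℂ} (h : AbsolutelyContinuousOnInterval f a b) :
    AbsContWithDeriv f (deriv f) a b := by
  refine ⟨h, ?_⟩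
  have hre : AbsolutelyContinuousOnInterval (fun t => (f t).re) a b :=
    absolutelyContinuousOnInterval_of_dist_le h 1 fun s _ t _ => by
      rw [Real.dist_eq, one_mul, dist_eq_norm, ← Complex.sub_re]; exact Complex.abs_re_le_norm _
  have him : AbsolutelyContinuousOnInterval (fun t => (f t).im) a b :=
    absolutelyContinuousOnInterval_of_dist_le h 1 fun s _ t _ => by
      rw [Real.dist_eq, one_mul, dist_eq_norm, ← Complex.sub_im]; exact Complex.abs_im_le_norm _
  filter_upwards [hre.ae_differentiableAt, him.ae_differentiableAt] with t h1 h2 hm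
  have h3 : DifferentiableAt ℝ (fun t => ((f t).re : ℂ) + ((f t).im : ℂ) * Complex.I) t :=
    (Complex.ofRealCLM.differentiableAt.comp t (h1 hm)).add
      ((Complex.ofRealCLM.differentiableAt.comp t (h2 hm)).mul_const _)
  simp only [Complex.re_add_im] at h3
  exact h3.hasDerivAt

theorem matDeriv_conjTranspose {n : ℕ} (A : ℝ → Matrix (Fin n) (Fin n) ℂ) (t : ℝ) :
    matDeriv (fun s => (A s)ᴴ) t = (matDeriv A t)ᴴ := by
  ext i j
  exact deriv.star

theorem MatAbsContOn.absContWithDeriv {n : ℕ} {A : ℝ → Matrix (Fin n) (Fin n) ℂ} {I : Set ℝ}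
    (h : MatAbsContOn A I) (hI : uIcc a b ⊆ I) : AbsContWithDeriv A (matDeriv A) a b :=
  absContWithDeriv_of_entries fun i j => absContWithDeriv_deriv (h a b hI i j)

theorem AbsContWithDeriv.ae_matDeriv_eq {n : ℕ} {A A' : ℝ → Matrix (Fin n) (Fin n) ℂ}
    (h : AbsContWithDeriv A A' a b) : ∀ᵐ t : ℝ, t ∈ uIcc a b → matDeriv A t = A' t := by
  have : ∀ i j, ∀ᵐ t : ℝ, t ∈ uIcc a b → HasDerivAt (fun s => A s i j) (A' t i j) t :=
    fun i j => (h.entry i j).hasDerivAt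
  filter_upwards [ae_all_iff.2 fun i => ae_all_iff.2 (this i)] with t ht hm
  ext i j
  exact (ht i j hm).deriv

theorem MatLocallyIntegrableOn.intervalIntegrable {n : ℕ} {A : ℝ → Matrix (Fin n) (Fin n) ℂ}
    {I : Set ℝ} (h : MatLocallyIntegrableOn A I) (hI : uIcc a b ⊆ I) :
    IntervalIntegrable A volume a b :=
  intervalIntegrable_of_entries fun i j =>
    ((h i j).integrableOn_compact_subset hI isCompact_uIcc).intervalIntegrable

end MatrixCalculus

section LinearUniqueness

variable {m : Type*} [Fintype m] [DecidableEq m] {a b : ℝ} {B X G : ℝ → Matrix m m ℂ}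

/-- A (left) integrating factor for `X' = B X`: the adjoint equation `Ψ' = -Ψ B`, `Ψ a = 1`, has a
solution, and it is invertible because its product with the fundamental solution of
`Φ' = B Φ` is constant. -/
theorem exists_integratingFactor (hab : a ≤ b) (hB : IntervalIntegrable B volume a b) :
    ∃ Ψ : ℝ → Matrix m m ℂ, Ψ a = 1 ∧ AbsContWithDeriv Ψ (fun t => -(Ψ t * B t)) a b ∧
      IsUnit (Ψ b) := by
  have hBs : IntervalIntegrable (fun t => -(B t)ᴴ) volume a b := by
    let L : Matrix m m ℂ →L[ℝ] Matrix m m ℂ := (starL' ℝ : Matrix m m ℂ ≃L[ℝ] Matrix m m ℂ)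
    have hL : IntervalIntegrable (fun t => L (B t)) volume a b :=
      ⟨L.integrable_comp hB.1, L.integrable_comp hB.2⟩
    exact hL.neg
  have hΨ := (absContWithDeriv_linearFlow 1 hab hBs).conjTranspose
  have hΨ' : AbsContWithDeriv (fun t => (linearFlow (fun t => -(B t)ᴴ) a 1 t)ᴴ)
      (fun t => -((linearFlow (fun t => -(B t)ᴴ) a 1 t)ᴴ * B t)) a b := by
    simpa using hΨ
  refine ⟨_, by simp [linearFlow_left], hΨ', ?_⟩
  have hprod := hΨ'.mul (absContWithDeriv_linearFlow 1 hab hB)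
  have hconst := hprod.eq_of_deriv_zero (Eventually.of_forall fun t _ => by noncomm_ring)
  simp only [linearFlow_left, Matrix.conjTranspose_one, mul_one] at hconst
  exact IsUnit.of_mul_eq_one _ hconst

theorem eq_zero_of_linear (hab : a ≤ b) (hB : IntervalIntegrable B volume a b)
    (hX : AbsContWithDeriv X (fun t => B t * X t) a b) (h0 : X a = 0) : X b = 0 := by
  obtain ⟨Ψ, -, hΨ, hu⟩ := exists_integratingFactor hab hB
  have h := (hΨ.mul hX).eq_of_deriv_zero (Eventually.of_forall fun t _ => by noncomm_ring)
  simp only [h0, mul_zero] at h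
  exact hu.mul_right_eq_zero.1 h

/-- If `X' = B X + G` and the inhomogeneity `G` annihilates `v` almost everywhere, then `X v`
solves a homogeneous equation; hence it can vanish at the right endpoint only if it vanishes at
the left one. -/
theorem mulVec_left_eq_zero (hab : a ≤ b) (hB : IntervalIntegrable B volume a b)
    (hX : AbsContWithDeriv X (fun t => B t * X t + G t) a b) {v : m → ℂ}
    (hG : ∀ᵐ t : ℝ, t ∈ uIcc a b → G t *ᵥ v = 0) (hb : X b *ᵥ v = 0) : X a *ᵥ v = 0 := by
  obtain ⟨Ψ, hΨa, hΨ, -⟩ := exists_integratingFactor hab hB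
  have h := ((hΨ.mul hX).clm_comp (mulVecCLM v)).eq_of_deriv_zero (by
    filter_upwards [hG] with t ht hm
    have : -(Ψ t * B t) * X t + Ψ t * (B t * X t + G t) = Ψ t * G t := by noncomm_ring
    rw [mulVecCLM_apply, this, ← Matrix.mulVec_mulVec, ht hm, Matrix.mulVec_zero])
  simp only [mulVecCLM_apply, ← Matrix.mulVec_mulVec, hb, hΨa, Matrix.one_mulVec,
    Matrix.mulVec_zero] at h
  exact h.symm

end LinearUniqueness

/-! ### The linear system and its Hermitian form -/

section QuadraticForms

variable {m : Type*} [Fintype m]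

theorem reForm_conj (v : m → ℂ) (A X : Matrix m m ℂ) :
    reForm v (Xᴴ * A * X) = reForm (X *ᵥ v) A := by
  rw [reForm_apply, reForm_apply, Matrix.star_mulVec, ← Matrix.dotProduct_mulVec,
    Matrix.mulVec_mulVec, Matrix.mulVec_mulVec, Matrix.mul_assoc]

theorem reForm_nonneg {A : Matrix m m ℂ} (hA : A.PosSemidef) (v : m → ℂ) : 0 ≤ reForm v A :=
  (Complex.le_def.1 (hA.dotProduct_mulVec_nonneg v)).1

theorem star_dotProduct_mulVec_eq_ofReal {A : Matrix m m ℂ} (hA : A.IsHermitian) (v : m → ℂ) :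
    star v ⬝ᵥ A *ᵥ v = (reForm v A : ℂ) := by
  refine Complex.ext (by simp [reForm_apply]) ?_
  rw [Complex.ofReal_im]
  exact hA.im_star_dotProduct_mulVec_self v

theorem posSemidef_of_reForm_nonneg {A : Matrix m m ℂ} (hA : A.IsHermitian)
    (h : ∀ v, 0 ≤ reForm v A) : A.PosSemidef :=
  Matrix.PosSemidef.of_dotProduct_mulVec_nonneg hA fun v => by
    rw [star_dotProduct_mulVec_eq_ofReal hA]; exact_mod_cast h v

theorem posDef_of_reForm_pos {A : Matrix m m ℂ} (hA : A.IsHermitian)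
    (h : ∀ v ≠ 0, 0 < reForm v A) : A.PosDef :=
  Matrix.PosDef.of_dotProduct_mulVec_pos hA fun v hv => by
    rw [star_dotProduct_mulVec_eq_ofReal hA]; exact_mod_cast h v hv

theorem reForm_pos {A : Matrix m m ℂ} (hA : A.PosDef) {v : m → ℂ} (hv : v ≠ 0) :
    0 < reForm v A :=
  (Complex.lt_def.1 (hA.dotProduct_mulVec_pos hv)).1

theorem reForm_conjTranspose_mul_self (v : m → ℂ) (X : Matrix m m ℂ) :
    0 ≤ reForm v (Xᴴ * X) :=
  reForm_nonneg (Matrix.posSemidef_conjTranspose_mul_self X) v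

theorem mulVec_eq_zero_of_reForm {v : m → ℂ} {X : Matrix m m ℂ}
    (h : reForm v (Xᴴ * X) = 0) : X *ᵥ v = 0 := by
  have h1 := star_dotProduct_mulVec_eq_ofReal (Matrix.isHermitian_conjTranspose_mul_self X) v
  rw [h, Complex.ofReal_zero, ← Matrix.mulVec_mulVec, Matrix.dotProduct_mulVec,
    ← Matrix.star_mulVec] at h1
  exact dotProduct_star_self_eq_zero.1 h1

end QuadraticForms

section Hamiltonian

variable {n : ℕ} {a b : ℝ} {P Q R S Λ W N : ℝ → Matrix (Fin n) (Fin n) ℂ} {μ : ℝ → ℝ}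

/-- The coordinate `V = U⁻¹ N - Λ W`, `U = P*`, of a solution `(W, N)` of the linear system. If
`Z = N W⁻¹`, then `V W⁻¹ = U⁻¹ Z - Λ`. -/
noncomputable def shifted (P Λ W N : ℝ → Matrix (Fin n) (Fin n) ℂ) (t : ℝ) :
    Matrix (Fin n) (Fin n) ℂ :=
  ((P t)ᴴ)⁻¹ * N t - Λ t * W t

/-- The Hermitian form `W* V + V* W`. If `Z = N W⁻¹`, it is congruent by `W` to
`U⁻¹ Z + Z* P⁻¹ - (Λ + Λ*)`. -/
noncomputable def energy (P Λ W N : ℝ → Matrix (Fin n) (Fin n) ℂ) (t : ℝ) :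
    Matrix (Fin n) (Fin n) ℂ :=
  (W t)ᴴ * shifted P Λ W N t + (shifted P Λ W N t)ᴴ * W t

/-- The coefficient `C = U⁻¹ U' + U⁻¹ Q U + Λ P U`, `U = P*`, of the system satisfied by
`(W, V)`. -/
noncomputable def driftCoeff (P Q Λ : ℝ → Matrix (Fin n) (Fin n) ℂ) (t : ℝ) :
    Matrix (Fin n) (Fin n) ℂ :=
  ((P t)ᴴ)⁻¹ * (matDeriv P t)ᴴ + ((P t)ᴴ)⁻¹ * Q t * (P t)ᴴ + Λ t * P t * (P t)ᴴ

/-- The substitution `N = U (V + Λ W)`. -/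
theorem conjTranspose_mul_shifted {t : ℝ} (hdet : (P t).det ≠ 0) :
    (P t)ᴴ * shifted P Λ W N t = N t - (P t)ᴴ * Λ t * W t := by
  have hu : IsUnit ((P t)ᴴ).det := by
    rw [Matrix.det_conjTranspose]; exact (hdet.isUnit).star
  rw [shifted, mul_sub, Matrix.mul_nonsing_inv_cancel_left _ _ hu, mul_assoc]

/-- `V' = -C V - S_{U,Λ} W`. -/
theorem absContWithDeriv_shifted
    (hP : AbsContWithDeriv P (matDeriv P) a b) (hdet : ∀ t ∈ uIcc a b, (P t).det ≠ 0)
    (hΛ : AbsContWithDeriv Λ (matDeriv Λ) a b)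
    (hW : AbsContWithDeriv W (fun t => R t * W t + P t * N t) a b)
    (hN : AbsContWithDeriv N (fun t => -(S t * W t) - Q t * N t) a b) :
    AbsContWithDeriv (shifted P Λ W N)
      (fun t => -(driftCoeff P Q Λ t * shifted P Λ W N t)
        - transformedS P Q R S (fun s => (P s)ᴴ) Λ t * W t) a b := by
  have hdet' : ∀ t ∈ uIcc a b, ((P t)ᴴ).det ≠ 0 := fun t ht => by
    rw [Matrix.det_conjTranspose]; exact star_ne_zero.2 (hdet t ht)
  refine (((hP.conjTranspose.inv hdet').mul hN).sub (hΛ.mul hW)).congr_deriv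
    (Eventually.of_forall fun t ht => ?_)
  have hsub := conjTranspose_mul_shifted (Λ := Λ) (W := W) (N := N) (hdet t ht)
  have hNt : N t = (P t)ᴴ * (shifted P Λ W N t + Λ t * W t) := by
    rw [mul_add, hsub]; noncomm_ring
  have hcancel : ((P t)ᴴ)⁻¹ * N t = shifted P Λ W N t + Λ t * W t := by
    rw [shifted]; noncomm_ring
  rw [transformedS, driftCoeff, matDeriv_conjTranspose]
  generalize shifted P Λ W N t = v at *
  have e1 : ((P t)ᴴ)⁻¹ * (matDeriv P t)ᴴ * ((P t)ᴴ)⁻¹ * N t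
      = ((P t)ᴴ)⁻¹ * (matDeriv P t)ᴴ * (v + Λ t * W t) := by
    rw [mul_assoc _ _ (N t), hcancel]
  rw [neg_mul, e1, hNt]
  noncomm_ring

/-- In the variables `(W, V)` the first equation reads `W' = P P* V + (C* + μ) W`, with the adjoint
of the coefficient `C` of the second one: this is the content of the hypothesis on `R`. -/
theorem absContWithDeriv_denominator (hdet : ∀ t ∈ uIcc a b, (P t).det ≠ 0)
    (hReq : ∀ᵐ t : ℝ, t ∈ uIcc a b →
      R t = P t * (Q t)ᴴ * (P t)⁻¹ + P t * (P t)ᴴ * ((Λ t)ᴴ - Λ t)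
        + matDeriv P t * (P t)⁻¹ + ((μ t : ℝ) : ℂ) • (1 : Matrix (Fin n) (Fin n) ℂ))
    (hW : AbsContWithDeriv W (fun t => R t * W t + P t * N t) a b) :
    AbsContWithDeriv W (fun t => P t * (P t)ᴴ * shifted P Λ W N t
      + ((driftCoeff P Q Λ t)ᴴ + ((μ t : ℝ) : ℂ) • 1) * W t) a b := by
  refine hW.congr_deriv ?_
  filter_upwards [hReq] with t ht hm
  have hsub := conjTranspose_mul_shifted (Λ := Λ) (W := W) (N := N) (hdet t hm)
  rw [mul_assoc (P t), hsub, ht hm, driftCoeff]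
  simp only [Matrix.conjTranspose_add, Matrix.conjTranspose_mul, Matrix.conjTranspose_nonsing_inv,
    Matrix.conjTranspose_conjTranspose]
  noncomm_ring

/-- `E' = μ E + 2 V* P P* V - W* (S_{U,Λ} + S_{U,Λ}*) W`: the terms with `C` cancel. -/
theorem absContWithDeriv_energy
    (hP : AbsContWithDeriv P (matDeriv P) a b) (hdet : ∀ t ∈ uIcc a b, (P t).det ≠ 0)
    (hΛ : AbsContWithDeriv Λ (matDeriv Λ) a b)
    (hReq : ∀ᵐ t : ℝ, t ∈ uIcc a b →
      R t = P t * (Q t)ᴴ * (P t)⁻¹ + P t * (P t)ᴴ * ((Λ t)ᴴ - Λ t)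
        + matDeriv P t * (P t)⁻¹ + ((μ t : ℝ) : ℂ) • (1 : Matrix (Fin n) (Fin n) ℂ))
    (hW : AbsContWithDeriv W (fun t => R t * W t + P t * N t) a b)
    (hN : AbsContWithDeriv N (fun t => -(S t * W t) - Q t * N t) a b) :
    AbsContWithDeriv (energy P Λ W N) (fun t => μ t • energy P Λ W N t
      + (2 : ℝ) • (((P t)ᴴ * shifted P Λ W N t)ᴴ * ((P t)ᴴ * shifted P Λ W N t))
      + (W t)ᴴ * -(transformedS P Q R S (fun s => (P s)ᴴ) Λ t
        + (transformedS P Q R S (fun s => (P s)ᴴ) Λ t)ᴴ) * W t) a b := by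
  have hV := absContWithDeriv_shifted hP hdet hΛ hW hN
  have hW' := absContWithDeriv_denominator hdet hReq hW
  refine ((hW'.conjTranspose.mul hV).add (hV.conjTranspose.mul hW')).congr_deriv
    (Eventually.of_forall fun t _ => ?_)
  rw [energy]
  generalize shifted P Λ W N t = v
  generalize transformedS P Q R S (fun s => (P s)ᴴ) Λ t = s
  generalize driftCoeff P Q Λ t = c
  have hμ : ∀ X : Matrix (Fin n) (Fin n) ℂ, ((μ t : ℝ) : ℂ) • X = μ t • X := fun X =>
    Complex.coe_smul _ _
  simp only [Matrix.conjTranspose_add, Matrix.conjTranspose_sub, Matrix.conjTranspose_neg,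
    Matrix.conjTranspose_mul, Matrix.conjTranspose_conjTranspose, Matrix.conjTranspose_smul,
    star_trivial, hμ, two_smul, add_mul, mul_add, smul_mul_assoc, mul_smul_comm, one_mul,
    smul_add]
  noncomm_ring

end Hamiltonian

/-! ### Comparison, global existence and uniqueness -/

section Comparison

variable {n : ℕ} {a b : ℝ} {P Q R S Λ W N : ℝ → Matrix (Fin n) (Fin n) ℂ} {μ : ℝ → ℝ}

/-- `(W, N)` solves the linear system `W' = R W + P N`, `N' = -S W - Q N` associated with the
Riccati equation on `[a, b]`, and the coefficients satisfy the structural hypotheses: `R` is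
determined by `P`, `Q`, `Λ`, `μ`, and the Hermitian part of `S_{P*, Λ}` is nonpositive. -/
structure LinearizedRiccati (P Q R S Λ W N : ℝ → Matrix (Fin n) (Fin n) ℂ) (μ : ℝ → ℝ)
    (a b : ℝ) : Prop where
  le : a ≤ b
  integrable_R : IntervalIntegrable R volume a b
  integrable_μ : IntervalIntegrable μ volume a b
  absCont_P : AbsContWithDeriv P (matDeriv P) a b
  det_ne_zero : ∀ t ∈ uIcc a b, (P t).det ≠ 0
  absCont_Λ : AbsContWithDeriv Λ (matDeriv Λ) a b
  R_eq : ∀ᵐ t : ℝ, t ∈ uIcc a b →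
    R t = P t * (Q t)ᴴ * (P t)⁻¹ + P t * (P t)ᴴ * ((Λ t)ᴴ - Λ t)
      + matDeriv P t * (P t)⁻¹ + ((μ t : ℝ) : ℂ) • (1 : Matrix (Fin n) (Fin n) ℂ)
  transformedS_nonpos : ∀ᵐ t : ℝ, t ∈ uIcc a b →
    (-(transformedS P Q R S (fun s => (P s)ᴴ) Λ t
      + (transformedS P Q R S (fun s => (P s)ᴴ) Λ t)ᴴ)).PosSemidef
  deriv_W : AbsContWithDeriv W (fun t => R t * W t + P t * N t) a b
  deriv_N : AbsContWithDeriv N (fun t => -(S t * W t) - Q t * N t) a b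

namespace LinearizedRiccati

/-- The integrating factor `exp (-∫ μ)` removes the only term of `E'` without a sign. -/
theorem absContWithDeriv_scaledEnergy (h : LinearizedRiccati P Q R S Λ W N μ a b)
    (v : Fin n → ℂ) :
    AbsContWithDeriv
      (fun t => Real.exp (-∫ s in a..t, μ s) * reForm v (energy P Λ W N t))
      (fun t => Real.exp (-∫ s in a..t, μ s) *
        (2 * reForm v (((P t)ᴴ * shifted P Λ W N t)ᴴ * ((P t)ᴴ * shifted P Λ W N t))
        + reForm (W t *ᵥ v) (-(transformedS P Q R S (fun s => (P s)ᴴ) Λ t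
          + (transformedS P Q R S (fun s => (P s)ᴴ) Λ t)ᴴ)))) a b := by
  have hE := (absContWithDeriv_energy h.absCont_P h.det_ne_zero h.absCont_Λ h.R_eq h.deriv_W
    h.deriv_N).clm_comp (reForm v)
  have hexp := (AbsContWithDeriv.integral h.integrable_μ).neg.exp
  refine (hexp.mul hE).congr_deriv (Eventually.of_forall fun t _ => ?_)
  rw [map_add, map_add, map_smul, map_smul, reForm_conj, smul_eq_mul, smul_eq_mul]
  ring

theorem scaledEnergy_deriv_nonneg (h : LinearizedRiccati P Q R S Λ W N μ a b) (v : Fin n → ℂ) :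
    ∀ᵐ t : ℝ, t ∈ Icc a b → 0 ≤ Real.exp (-∫ s in a..t, μ s) *
        (2 * reForm v (((P t)ᴴ * shifted P Λ W N t)ᴴ * ((P t)ᴴ * shifted P Λ W N t))
        + reForm (W t *ᵥ v) (-(transformedS P Q R S (fun s => (P s)ᴴ) Λ t
          + (transformedS P Q R S (fun s => (P s)ᴴ) Λ t)ᴴ))) := by
  filter_upwards [h.transformedS_nonpos] with t ht hm
  have h1 := reForm_conjTranspose_mul_self v ((P t)ᴴ * shifted P Λ W N t)
  have h2 := reForm_nonneg (ht (by rwa [uIcc_of_le h.le])) (W t *ᵥ v)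
  positivity

theorem energy_le (h : LinearizedRiccati P Q R S Λ W N μ a b) (v : Fin n → ℂ) :
    reForm v (energy P Λ W N a)
      ≤ Real.exp (-∫ s in a..b, μ s) * reForm v (energy P Λ W N b) := by
  simpa using (h.absContWithDeriv_scaledEnergy v).le_of_deriv_nonneg h.le
    (h.scaledEnergy_deriv_nonneg v)

/-- If the form `v* E v` is nonnegative at `a` and vanishes at `b`, the scaled form is constant on
`[a, b]`, and the term `2 ‖P* V v‖²` of its derivative vanishes. -/
theorem ae_shifted_mulVec_eq_zero (h : LinearizedRiccati P Q R S Λ W N μ a b) {v : Fin n → ℂ}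
    (ha : 0 ≤ reForm v (energy P Λ W N a)) (hb : reForm v (energy P Λ W N b) = 0) :
    ∀ᵐ t : ℝ, t ∈ uIcc a b → ((P t)ᴴ * shifted P Λ W N t) *ᵥ v = 0 := by
  have hzero := (h.absContWithDeriv_scaledEnergy v).deriv_eq_zero_of_le h.le
    (h.scaledEnergy_deriv_nonneg v) (by simpa [hb] using ha)
  filter_upwards [hzero, h.transformedS_nonpos] with t ht hS hm
  have h1 := reForm_conjTranspose_mul_self v ((P t)ᴴ * shifted P Λ W N t)
  have h2 := reForm_nonneg (hS hm) (W t *ᵥ v)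
  have h3 := (mul_eq_zero.1 (ht (by rwa [uIcc_of_le h.le] at hm))).resolve_left
    (Real.exp_pos _).ne'
  exact mulVec_eq_zero_of_reForm (by linarith)

/-- The denominator `W` stays invertible, so that `N W⁻¹` does not blow up. A null vector `v` of
`W b` is a null vector of the form `E b`; by monotonicity `V v = 0` on `[a, b]`, so `W v` solves a
homogeneous linear equation, and it vanishes at `b` but not at `a`. -/
theorem det_denominator_ne_zero (h : LinearizedRiccati P Q R S Λ W N μ a b) (hWa : W a = 1)
    (ha : (energy P Λ W N a).PosSemidef) : (W b).det ≠ 0 := by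
  intro hdet
  obtain ⟨v, hv, hWv⟩ := Matrix.exists_mulVec_eq_zero_iff.2 hdet
  have hb : reForm v (energy P Λ W N b) = 0 := by
    rw [reForm_apply, energy, Matrix.add_mulVec, ← Matrix.mulVec_mulVec, ← Matrix.mulVec_mulVec,
      hWv, Matrix.mulVec_zero, add_zero, Matrix.dotProduct_mulVec, ← Matrix.star_mulVec, hWv]
    simp
  have hV := h.ae_shifted_mulVec_eq_zero (reForm_nonneg ha v) hb
  have hB : IntervalIntegrable (fun t => R t + P t * (P t)ᴴ * Λ t) volume a b :=
    h.integrable_R.add ((h.absCont_P.mul h.absCont_P.conjTranspose).mul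
      h.absCont_Λ).continuousOn.intervalIntegrable
  have hW : AbsContWithDeriv W (fun t => (R t + P t * (P t)ᴴ * Λ t) * W t
      + P t * ((P t)ᴴ * shifted P Λ W N t)) a b := by
    refine h.deriv_W.congr_deriv (Eventually.of_forall fun t hm => ?_)
    rw [conjTranspose_mul_shifted (h.det_ne_zero t hm)]
    noncomm_ring
  have hzero := mulVec_left_eq_zero h.le hB hW (v := v) (by
    filter_upwards [hV] with t ht hm
    rw [← Matrix.mulVec_mulVec, ht hm, Matrix.mulVec_zero]) hWv
  rw [hWa, Matrix.one_mulVec] at hzero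
  exact hv hzero

end LinearizedRiccati

theorem isHermitian_energy (t : ℝ) : (energy P Λ W N t).IsHermitian := by
  simp [Matrix.IsHermitian, energy, Matrix.conjTranspose_add, add_comm]

/-- For `Z = N W⁻¹`, the matrix `P⁻* Z + Z* P⁻¹ - (Λ + Λ*)` equals `W⁻* E W⁻¹`. -/
theorem form_eq_congr_energy {t : ℝ} (hW : (W t).det ≠ 0) :
    ((P t)⁻¹)ᴴ * (N t * (W t)⁻¹) + (N t * (W t)⁻¹)ᴴ * (P t)⁻¹ - (Λ t + (Λ t)ᴴ)
      = ((W t)⁻¹)ᴴ * energy P Λ W N t * (W t)⁻¹ := by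
  have h1 : W t * (W t)⁻¹ = 1 := Matrix.mul_nonsing_inv _ hW.isUnit
  have h2 : ((W t)⁻¹)ᴴ * (W t)ᴴ = 1 := by
    rw [← Matrix.conjTranspose_mul, h1, Matrix.conjTranspose_one]
  have h3 : ((W t)⁻¹)ᴴ * energy P Λ W N t * (W t)⁻¹
      = (((W t)⁻¹)ᴴ * (W t)ᴴ) * shifted P Λ W N t * (W t)⁻¹
        + ((W t)⁻¹)ᴴ * (shifted P Λ W N t)ᴴ * (W t * (W t)⁻¹) := by
    rw [energy]; noncomm_ring
  have h4 : shifted P Λ W N t * (W t)⁻¹ = ((P t)⁻¹)ᴴ * (N t * (W t)⁻¹) - Λ t := by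
    rw [shifted, sub_mul, mul_assoc (Λ t), h1, mul_one, Matrix.conjTranspose_nonsing_inv, mul_assoc]
  rw [h3, h1, h2, one_mul, mul_one, ← Matrix.conjTranspose_mul, h4]
  simp only [Matrix.conjTranspose_sub, Matrix.conjTranspose_mul, Matrix.conjTranspose_conjTranspose]
  abel

/-- The linear system `W' = R W + P N`, `N' = -S W - Q N` with `W t₀ = 1`, `N t₀ = M` has a
solution on the whole half-line. -/
theorem exists_linearization (t₀ : ℝ) (hP : ∀ b, t₀ ≤ b → IntervalIntegrable P volume t₀ b)
    (hQ : ∀ b, t₀ ≤ b → IntervalIntegrable Q volume t₀ b)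
    (hR : ∀ b, t₀ ≤ b → IntervalIntegrable R volume t₀ b)
    (hS : ∀ b, t₀ ≤ b → IntervalIntegrable S volume t₀ b) (M : Matrix (Fin n) (Fin n) ℂ) :
    ∃ W N : ℝ → Matrix (Fin n) (Fin n) ℂ, W t₀ = 1 ∧ N t₀ = M ∧ ∀ b, t₀ ≤ b →
      AbsContWithDeriv W (fun t => R t * W t + P t * N t) t₀ b ∧
      AbsContWithDeriv N (fun t => -(S t * W t) - Q t * N t) t₀ b := by
  have hA : ∀ b, t₀ ≤ b → IntervalIntegrable
      (fun t => Matrix.fromBlocks (R t) (P t) (-S t) (-Q t)) volume t₀ b := by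
    intro b hb
    have hent : ∀ {A : ℝ → Matrix (Fin n) (Fin n) ℂ}, IntervalIntegrable A volume t₀ b →
        ∀ i j, IntervalIntegrable (fun t => A t i j) volume t₀ b := fun h i j =>
      ⟨(entryCLM i j).integrable_comp h.1, (entryCLM i j).integrable_comp h.2⟩
    refine intervalIntegrable_of_entries ?_
    rintro (i | i) (j | j)
    · exact hent (hR b hb) i j
    · exact hent (hP b hb) i j
    · exact (hent (hS b hb) i j).neg
    · exact (hent (hQ b hb) i j).neg
  set X := linearFlow (fun t => Matrix.fromBlocks (R t) (P t) (-S t) (-Q t)) t₀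
    (Matrix.fromBlocks 1 0 M 0) with hX
  have hX₀ : X t₀ = Matrix.fromBlocks 1 0 M 0 := linearFlow_left _ _ _
  refine ⟨fun t => (X t).toBlocks₁₁, fun t => (X t).toBlocks₂₁, by simp [hX₀], by simp [hX₀],
    fun b hb => ?_⟩
  have hflow := absContWithDeriv_linearFlow (Matrix.fromBlocks 1 0 M 0) hb (hA b hb)
  rw [← hX] at hflow
  constructor
  · refine absContWithDeriv_of_entries fun i j => ?_
    have := hflow.entry (Sum.inl i) (Sum.inl j)
    simpa [Matrix.mul_apply, Matrix.toBlocks₁₁, Matrix.toBlocks₂₁] using this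
  · refine absContWithDeriv_of_entries fun i j => ?_
    have := hflow.entry (Sum.inr i) (Sum.inl j)
    simpa [Matrix.mul_apply, Matrix.toBlocks₁₁, Matrix.toBlocks₂₁, sub_eq_add_neg] using this

/-- Any solution `Y` of the Riccati equation with the right initial value is `N W⁻¹`: the defect
`N - Y W` solves the homogeneous linear equation `D' = -(Q + Y P) D`. -/
theorem solution_mul_denominator (hab : a ≤ b) (hQ : IntervalIntegrable Q volume a b)
    (hP : ContinuousOn P (uIcc a b))
    (hW : AbsContWithDeriv W (fun t => R t * W t + P t * N t) a b)
    (hN : AbsContWithDeriv N (fun t => -(S t * W t) - Q t * N t) a b)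
    {Y : ℝ → Matrix (Fin n) (Fin n) ℂ} (hY : AbsContWithDeriv Y (matDeriv Y) a b)
    (heq : ∀ᵐ t : ℝ, t ∈ uIcc a b →
      matDeriv Y t + Y t * P t * Y t + Q t * Y t + Y t * R t + S t = 0)
    (ha : N a = Y a * W a) : N b = Y b * W b := by
  have hB : IntervalIntegrable (fun t => -(Q t + Y t * P t)) volume a b :=
    (hQ.add (hY.continuousOn.mul hP).intervalIntegrable).neg
  refine sub_eq_zero.1 (eq_zero_of_linear hab hB (X := fun t => N t - Y t * W t) ?_
    (sub_eq_zero.2 ha))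
  refine (hN.sub (hY.mul hW)).congr_deriv ?_
  filter_upwards [heq] with t ht hm
  have : matDeriv Y t = -(Y t * P t * Y t + Q t * Y t + Y t * R t + S t) := by
    rw [eq_neg_iff_add_eq_zero, ← ht hm]; abel
  rw [this]
  noncomm_ring

theorem isSolutionOn_of_linearization {t₀ : ℝ} (hdet : ∀ t, t₀ ≤ t → (W t).det ≠ 0)
    (hW : ∀ b, t₀ ≤ b → AbsContWithDeriv W (fun t => R t * W t + P t * N t) t₀ b)
    (hN : ∀ b, t₀ ≤ b → AbsContWithDeriv N (fun t => -(S t * W t) - Q t * N t) t₀ b) :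
    IsSolutionOn P Q R S (Ici t₀) (fun t => N t * (W t)⁻¹) := by
  have hmem : ∀ {b}, t₀ ≤ b → ∀ t ∈ uIcc t₀ b, t₀ ≤ t := fun hb t ht => by
    rw [uIcc_of_le hb] at ht; exact ht.1
  have hZ : ∀ b, t₀ ≤ b → AbsContWithDeriv (fun t => N t * (W t)⁻¹) (fun t =>
      -(N t * (W t)⁻¹ * P t * (N t * (W t)⁻¹) + Q t * (N t * (W t)⁻¹) + N t * (W t)⁻¹ * R t
        + S t)) t₀ b := by
    intro b hb
    refine ((hN b hb).mul ((hW b hb).inv fun t ht => hdet t (hmem hb t ht))).congr_deriv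
      (Eventually.of_forall fun t ht => ?_)
    have h1 : W t * (W t)⁻¹ = 1 := Matrix.mul_nonsing_inv _ (hdet t (hmem hb t ht)).isUnit
    have h2 : (-(S t * W t) - Q t * N t) * (W t)⁻¹
        + N t * -((W t)⁻¹ * (R t * W t + P t * N t) * (W t)⁻¹)
        = -(S t * (W t * (W t)⁻¹)) - Q t * N t * (W t)⁻¹
          - N t * (W t)⁻¹ * R t * (W t * (W t)⁻¹)
          - N t * (W t)⁻¹ * P t * N t * (W t)⁻¹ := by noncomm_ring
    rw [h2, h1]
    noncomm_ring
  refine ⟨fun a b hab i j => ?_, ?_⟩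
  · have hmax : t₀ ≤ max a b := (hab left_mem_uIcc).trans (le_max_left a b)
    refine ((hZ _ hmax).entry i j).absCont.mono ?_
    intro t ht
    rw [uIcc_of_le hmax]
    exact ⟨hab ht, ht.2⟩
  · have hk : ∀ k : ℕ, t₀ ≤ t₀ + k := fun k => by simp
    filter_upwards [ae_all_iff.2 fun k : ℕ => (hZ _ (hk k)).ae_matDeriv_eq] with t ht hm
    obtain ⟨k, hkt⟩ := exists_nat_ge (t - t₀)
    rw [ht k (by rw [uIcc_of_le (hk k)]; exact ⟨hm, by linarith⟩)]
    abel

/-- Global existence, uniqueness, and preservation of both the nonstrict and the strict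
inequality. -/
theorem exists_solution_of_posSemidef (t₀ : ℝ) (hQ : MatLocallyIntegrableOn Q (Ici t₀))
    (hR : MatLocallyIntegrableOn R (Ici t₀)) (hS : MatLocallyIntegrableOn S (Ici t₀))
    (hPac : MatAbsContOn P (Ici t₀)) (hPdet : ∀ t, t₀ ≤ t → (P t).det ≠ 0)
    (hΛac : MatAbsContOn Λ (Ici t₀)) (hμ : LocallyIntegrableOn μ (Ici t₀))
    (hReq : ∀ᵐ t : ℝ, t₀ ≤ t →
      R t = P t * (Q t)ᴴ * (P t)⁻¹ + P t * (P t)ᴴ * ((Λ t)ᴴ - Λ t)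
        + matDeriv P t * (P t)⁻¹ + ((μ t : ℝ) : ℂ) • (1 : Matrix (Fin n) (Fin n) ℂ))
    (hSneg : ∀ᵐ t : ℝ, t₀ ≤ t →
      (-(transformedS P Q R S (fun s => (P s)ᴴ) Λ t
        + (transformedS P Q R S (fun s => (P s)ᴴ) Λ t)ᴴ)).PosSemidef)
    (M : Matrix (Fin n) (Fin n) ℂ)
    (hM : (((P t₀)⁻¹)ᴴ * M + Mᴴ * (P t₀)⁻¹ - (Λ t₀ + (Λ t₀)ᴴ)).PosSemidef) :
    ∃ Z : ℝ → Matrix (Fin n) (Fin n) ℂ, IsSolutionOn P Q R S (Ici t₀) Z ∧ Z t₀ = M ∧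
      (∀ T : ℝ, t₀ < T → ∀ Y : ℝ → Matrix (Fin n) (Fin n) ℂ,
        IsSolutionOn P Q R S (Ico t₀ T) Y → Y t₀ = M → EqOn Y Z (Ico t₀ T)) ∧
      ∀ t, t₀ ≤ t →
        (((P t)⁻¹)ᴴ * Z t + (Z t)ᴴ * (P t)⁻¹ - (Λ t + (Λ t)ᴴ)).PosSemidef ∧
        ((((P t₀)⁻¹)ᴴ * M + Mᴴ * (P t₀)⁻¹ - (Λ t₀ + (Λ t₀)ᴴ)).PosDef →
          (((P t)⁻¹)ᴴ * Z t + (Z t)ᴴ * (P t)⁻¹ - (Λ t + (Λ t)ᴴ)).PosDef) := by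
  have hsub : ∀ b, t₀ ≤ b → uIcc t₀ b ⊆ Ici t₀ := fun b hb => by
    rw [uIcc_of_le hb]; exact Icc_subset_Ici_self
  have hP : ∀ b, t₀ ≤ b → AbsContWithDeriv P (matDeriv P) t₀ b := fun b hb =>
    hPac.absContWithDeriv (hsub b hb)
  obtain ⟨W, N, hW₀, hN₀, hWN⟩ := exists_linearization t₀
    (fun b hb => (hP b hb).continuousOn.intervalIntegrable)
    (fun b hb => hQ.intervalIntegrable (hsub b hb))
    (fun b hb => hR.intervalIntegrable (hsub b hb))
    (fun b hb => hS.intervalIntegrable (hsub b hb)) M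
  have hlin : ∀ b, t₀ ≤ b → LinearizedRiccati P Q R S Λ W N μ t₀ b := fun b hb =>
    { le := hb
      integrable_R := hR.intervalIntegrable (hsub b hb)
      integrable_μ :=
        (hμ.integrableOn_compact_subset (hsub b hb) isCompact_uIcc).intervalIntegrable
      absCont_P := hP b hb
      det_ne_zero := fun t ht => hPdet t (hsub b hb ht)
      absCont_Λ := hΛac.absContWithDeriv (hsub b hb)
      R_eq := by filter_upwards [hReq] with t ht hm using ht (hsub b hb hm)
      transformedS_nonpos := by filter_upwards [hSneg] with t ht hm using ht (hsub b hb hm)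
      deriv_W := (hWN b hb).1
      deriv_N := (hWN b hb).2 }
  have hE₀ : energy P Λ W N t₀
      = ((P t₀)⁻¹)ᴴ * M + Mᴴ * (P t₀)⁻¹ - (Λ t₀ + (Λ t₀)ᴴ) := by
    have := form_eq_congr_energy (P := P) (Λ := Λ) (W := W) (N := N) (t := t₀) (by simp [hW₀])
    simpa [hW₀, hN₀] using this.symm
  rw [← hE₀] at hM ⊢
  have hdet : ∀ t, t₀ ≤ t → (W t).det ≠ 0 := fun t ht =>
    (hlin t ht).det_denominator_ne_zero hW₀ hM
  refine ⟨fun t => N t * (W t)⁻¹, isSolutionOn_of_linearization hdet (fun b hb => (hWN b hb).1)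
    fun b hb => (hWN b hb).2, by simp [hW₀, hN₀], ?_, ?_⟩
  · intro T _ Y hY hY₀ t ht
    have hsubT : uIcc t₀ t ⊆ Ico t₀ T := by
      rw [uIcc_of_le ht.1]; exact fun s hs => ⟨hs.1, hs.2.trans_lt ht.2⟩
    have := solution_mul_denominator ht.1 (hQ.intervalIntegrable (hsub t ht.1))
      (hP t ht.1).continuousOn (hWN t ht.1).1 (hWN t ht.1).2 (hY.1.absContWithDeriv hsubT)
      (by filter_upwards [hY.2] with s hs hm using hs (hsubT hm)) (by rw [hN₀, hY₀, hW₀, mul_one])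
    change Y t = N t * (W t)⁻¹
    rw [this, Matrix.mul_nonsing_inv_cancel_right _ _ (hdet t ht.1).isUnit]
  · intro t ht
    rw [form_eq_congr_energy (hdet t ht)]
    have hunit : IsUnit (W t)⁻¹ := by
      rw [Matrix.isUnit_nonsing_inv_iff, Matrix.isUnit_iff_isUnit_det]
      exact (hdet t ht).isUnit
    constructor
    · refine (posSemidef_of_reForm_nonneg (isHermitian_energy t) fun v => ?_
        ).conjTranspose_mul_mul_same _
      exact nonneg_of_mul_nonneg_right ((reForm_nonneg hM v).trans ((hlin t ht).energy_le v))
        (Real.exp_pos _)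
    · intro hpos
      refine (posDef_of_reForm_pos (isHermitian_energy t) fun v hv => ?_
        ).conjTranspose_mul_mul_same (Matrix.mulVec_injective_of_isUnit hunit)
      exact pos_of_mul_pos_right ((reForm_pos hpos hv).trans_le ((hlin t ht).energy_le v))
        (Real.exp_pos _).le

end Comparison

end MatrixRiccati

theorem corollary3p1 (n : ℕ) (t₀ : ℝ) (P Q R S Λ : ℝ → Matrix (Fin n) (Fin n) ℂ) (μ : ℝ → ℝ)
    (hQ : MatrixRiccati.MatLocallyIntegrableOn Q (Set.Ici t₀))
    (hR : MatrixRiccati.MatLocallyIntegrableOn R (Set.Ici t₀))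
    (hS : MatrixRiccati.MatLocallyIntegrableOn S (Set.Ici t₀))
    (hPac : MatrixRiccati.MatAbsContOn P (Set.Ici t₀))
    (hPdet : ∀ t, t₀ ≤ t → (P t).det ≠ 0)
    (hΛac : MatrixRiccati.MatAbsContOn Λ (Set.Ici t₀))
    (hμ : MeasureTheory.LocallyIntegrableOn μ (Set.Ici t₀))
    (hReq : ∀ᵐ t : ℝ, t₀ ≤ t →
      R t = P t * (Q t)ᴴ * (P t)⁻¹ + P t * (P t)ᴴ * ((Λ t)ᴴ - Λ t)
        + MatrixRiccati.matDeriv P t * (P t)⁻¹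
        + ((μ t : ℝ) : ℂ) • (1 : Matrix (Fin n) (Fin n) ℂ))
    (hSneg : ∀ᵐ t : ℝ, t₀ ≤ t →
      (-(MatrixRiccati.transformedS P Q R S (fun s => (P s)ᴴ) Λ t
        + (MatrixRiccati.transformedS P Q R S (fun s => (P s)ᴴ) Λ t)ᴴ)).PosSemidef) :
    -- strict inequality
    (∀ M : Matrix (Fin n) (Fin n) ℂ,
      (((P t₀)⁻¹)ᴴ * M + Mᴴ * (P t₀)⁻¹ - (Λ t₀ + (Λ t₀)ᴴ)).PosDef →
      ∃ Z : ℝ → Matrix (Fin n) (Fin n) ℂ,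
        MatrixRiccati.IsSolutionOn P Q R S (Set.Ici t₀) Z ∧ Z t₀ = M ∧
        -- every solution with this initial value is a restriction of `Z`
        (∀ T : ℝ, t₀ < T → ∀ Y : ℝ → Matrix (Fin n) (Fin n) ℂ,
          MatrixRiccati.IsSolutionOn P Q R S (Set.Ico t₀ T) Y → Y t₀ = M →
          Set.EqOn Y Z (Set.Ico t₀ T)) ∧
        ∀ t, t₀ ≤ t →
          (((P t)⁻¹)ᴴ * Z t + (Z t)ᴴ * (P t)⁻¹ - (Λ t + (Λ t)ᴴ)).PosDef) ∧
    -- non-strict inequality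
    (((P t₀)⁻¹ + ((P t₀)⁻¹)ᴴ).PosDef →
      ∀ M : Matrix (Fin n) (Fin n) ℂ,
      (((P t₀)⁻¹)ᴴ * M + Mᴴ * (P t₀)⁻¹ - (Λ t₀ + (Λ t₀)ᴴ)).PosSemidef →
      ∃ Z : ℝ → Matrix (Fin n) (Fin n) ℂ,
        MatrixRiccati.IsSolutionOn P Q R S (Set.Ici t₀) Z ∧ Z t₀ = M ∧
        (∀ T : ℝ, t₀ < T → ∀ Y : ℝ → Matrix (Fin n) (Fin n) ℂ,
          MatrixRiccati.IsSolutionOn P Q R S (Set.Ico t₀ T) Y → Y t₀ = M →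
          Set.EqOn Y Z (Set.Ico t₀ T)) ∧
        ∀ t, t₀ ≤ t →
          (((P t)⁻¹)ᴴ * Z t + (Z t)ᴴ * (P t)⁻¹ - (Λ t + (Λ t)ᴴ)).PosSemidef) := by
  have key := MatrixRiccati.exists_solution_of_posSemidef t₀ hQ hR hS hPac hPdet hΛac hμ hReq hSneg
  refine ⟨fun M hM => ?_, fun _ M hM => ?_⟩
  · obtain ⟨Z, hZ, hZ₀, huniq, hpos⟩ := key M hM.posSemidef
    exact ⟨Z, hZ, hZ₀, huniq, fun t ht => (hpos t ht).2 hM⟩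
  · obtain ⟨Z, hZ, hZ₀, huniq, hpos⟩ := key M hM
    exact ⟨Z, hZ, hZ₀, huniq, fun t ht => (hpos t ht).1⟩
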